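/- **Corollary 3.** Let $\lambda_S,\lambda_{PT},R_p,R_I,\alpha>0$, $\beta\in(0,1)$ and $c>0$ be fixed. In the plane $\mathbb R^2$, let the primary transmitters form a homogeneous Poisson point process of density $\lambda_{PT}$; independently of the transmitters and of each other, let the receiver of each primary transmitter be uniformly distributed in the closed disk of radius $R_p$ around it; and let the secondary users form a Poisson point process of density $\lambda_S$ independent of the primary transmitters and receivers. Let secondary users with transmission power $p_{tx}>0$ have interference range $r_I=c\,p_{tx}^{1/\alpha}$ and transmission range $r_p=\beta r_I$, where $\alpha$ is the path-loss exponent. A secondary user sees an opportunity if there is no primary receiver within distance $r_I$ of it and no primary transmitter within distance $R_I$ of it; two secondary users are linked if and only if their distance is at most $r_p$ and both see an opportunity. For a (typical) secondary user $A$, located at a fixed point of the plane in addition to the Poisson process of the other secondary users, let $\deg(A)$ be the number of secondary users linked to $A$, and let $$\mu=\mathbb E[\deg(A)\mid A\text{ sees an opportunity}]$$ be its conditional average degree. Then, for every $p_{tx}>0$, the conditioning event has positive probability and $\mu<\infty$, and $$\mu=O\big(p_{tx}^{-2/\alpha}\big)\quad\text{as }p_{tx}\to\infty .$$ Moreover,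 $\mu\le \dfrac{2\pi\lambda_S}{\lambda_{PT}^2\,r_I^2}$ whenever $r_I\ge R_p+R_I$. -/

import Mathlib

open MeasureTheory ProbabilityTheory Filter Asymptotics
open scoped ENNReal NNReal

/-- The Euclidean plane. -/
abbrev Plane : Type := EuclideanSpace ℝ (Fin 2)

/-- The random points `X 0, X 1, …` of the plane enumerate a homogeneous Poisson point process of
density `lam`: the number of points in a Borel set of finite area is Poisson with mean
`lam * area`, and the numbers of points in pairwise disjoint Borel sets are independent. -/
structure IsPoissonProcess {Ω : Type*} [MeasurableSpace Ω] (P : Measure Ω) (lam : ℝ≥0)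
    (X : ℕ → Ω → Plane) : Prop where
  measurable : ∀ i, Measurable (X i)
  poisson : ∀ B : Set Plane, MeasurableSet B → volume B ≠ ∞ → ∀ k : ℕ,
    P {ω | {i | X i ω ∈ B}.encard = k} = poissonMeasure (lam * (volume B).toNNReal) {k}
  indep : ∀ (n : ℕ) (B : Fin n → Set Plane), (∀ j, MeasurableSet (B j)) →
    Pairwise (fun j k => Disjoint (B j) (B k)) →
    iIndepFun (fun j ω => {i | X i ω ∈ B j}.encard) P

/-- The primary network: the transmitters `T i` form a Poisson process of density `lamPT`, and,
independently of the transmitters and of each other, the receiver `V i` of the transmitter `T i`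
is uniformly distributed in the disk of radius `Rp` around `T i`. -/
structure IsPrimaryNetwork {Ω : Type*} [MeasurableSpace Ω] (P : Measure Ω) (lamPT : ℝ≥0) (Rp : ℝ)
    (T V : ℕ → Ω → Plane) : Prop where
  transmitters : IsPoissonProcess P lamPT T
  receiver_measurable : ∀ i, Measurable (V i)
  uniform : ∀ i, pdf.IsUniform (fun ω => V i ω - T i ω) (Metric.closedBall (0 : Plane) Rp) P volume
  displacements_indep : iIndepFun (fun i ω => V i ω - T i ω) P
  indep_transmitters : IndepFun (fun ω i => T i ω) (fun ω i => V i ω - T i ω) P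

/-- The heterogeneous network: a primary network `T, V` and an independent Poisson process `U`
of secondary users of density `lamS`. -/
structure IsHeterogeneousNetwork {Ω : Type*} [MeasurableSpace Ω] (P : Measure Ω)
    (lamS lamPT : ℝ≥0) (Rp : ℝ) (T V U : ℕ → Ω → Plane) : Prop where
  primary : IsPrimaryNetwork P lamPT Rp T V
  secondary : IsPoissonProcess P lamS U
  indep : IndepFun (fun ω => ((fun i => T i ω), (fun i => V i ω))) (fun ω i => U i ω) P

/-- Some of the points `z i` lies within distance `d` of `x`. -/
def HasPointWithin (x : Plane) (d : ℝ) (z : ℕ → Plane) : Prop :=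
  ∃ i, dist x (z i) ≤ d

/-- A user at `x` sees a spectrum opportunity: there is no primary receiver `v i` within distance
`rI` and no primary transmitter `t i` within distance `RI` of `x`. -/
def SeesOpportunity (rI RI : ℝ) (t v : ℕ → Plane) (x : Plane) : Prop :=
  ¬ HasPointWithin x rI v ∧ ¬ HasPointWithin x RI t

/-- The graph of bidirectional links among secondary users at the positions `u i`: two users are
linked iff they are at distance at most `rp` and both see a spectrum opportunity. -/
def secondaryGraph {ι : Type*} (rp rI RI : ℝ) (t v : ℕ → Plane) (u : ι → Plane) :
    SimpleGraph ι where
  Adj i j := i ≠ j ∧ dist (u i) (u j) ≤ rp ∧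
    SeesOpportunity rI RI t v (u i) ∧ SeesOpportunity rI RI t v (u j)
  symm := ⟨fun _ _ h => ⟨h.1.symm, by rw [dist_comm]; exact h.2.1, h.2.2.2, h.2.2.1⟩⟩
  loopless := ⟨fun _ h => h.1 rfl⟩

/-- Positions of the secondary users when there is a (typical) user at `a` (index `none`) besides
the users `u i` (indices `some i`). -/
def addUser (a : Plane) (u : ℕ → Plane) : Option ℕ → Plane
  | none => a
  | some i => u i

/-- Degree of the user at `a` in the graph of bidirectional links. -/
noncomputable def userDegree (rp rI RI : ℝ) (t v u : ℕ → Plane) (a : Plane) : ℕ∞ :=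
  ((secondaryGraph rp rI RI t v (addUser a u)).neighborSet none).encard

/-- The event that the user at `a` sees a spectrum opportunity. -/
def opportunityEvent {Ω : Type*} (rI RI : ℝ) (T V : ℕ → Ω → Plane) (a : Plane) : Set Ω :=
  {ω | SeesOpportunity rI RI (fun i => T i ω) (fun i => V i ω) a}

/-- Conditional average degree of the user at `a`: the expectation of its degree conditioned on
the event that it sees a spectrum opportunity. -/
noncomputable def condAvgDegree {Ω : Type*} [MeasurableSpace Ω] (P : Measure Ω) (rp rI RI : ℝ)
    (T V U : ℕ → Ω → Plane) (a : Plane) : ℝ≥0∞ :=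
  ∫⁻ ω, (userDegree rp rI RI (fun i => T i ω) (fun i => V i ω) (fun i => U i ω) a : ℝ≥0∞)
    ∂(ProbabilityTheory.cond P (opportunityEvent rI RI T V a))

/-! Once `Rp + RI ≤ rI`, a transmitter within `RI` of a user almost surely has its receiver within
`rI`, so seeing an opportunity just means that a disk of radius `rI` contains no receiver. By the
displacement theorem, receivers have the void probabilities of a Poisson process of density `lamPT`.
Hence, given that `a` sees an opportunity, `x` does so with probability `exp (-lamPT * |B(x) \
B(a)|)`, and this crescent has area at least `rI * dist x a` when `dist x a ≤ rI`.

Campbell's formula (`condAvgDegree_eq`) writes `μ` as `lamS` times the integral of this conditional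
probability over the disk of radius `rp` around `a`. Enlarging the domain to the whole plane gives
`lamS * ∫ exp (-lamPT * rI * |x - a|) dx = 2π lamS / (lamPT * rI)²`, which is of order `p ^ (-2 /
α)`.

The probabilistic work is the displacement theorem, obtained from the probability generating
functional of the transmitters; the geometric work is the crescent estimate. -/

theorem encard_toENNReal_eq_tsum_indicator {ι : Type*} (s : Set ι) :
    (s.encard : ℝ≥0∞) = ∑' i, s.indicator 1 i := by
  rw [← ENNReal.tsum_set_one, ← tsum_subtype]
  rfl

theorem measurable_encard_setOf {Ω : Type*} [MeasurableSpace Ω] {S : ℕ → Set Ω}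
    (hS : ∀ i, MeasurableSet (S i)) : Measurable fun ω => {i | ω ∈ S i}.encard := by
  have h : Measurable fun ω => ({i | ω ∈ S i}.encard : ℝ≥0∞) := by
    have heq : (fun ω => ({i | ω ∈ S i}.encard : ℝ≥0∞)) =
        fun ω => ∑' i, (S i).indicator 1 ω := by
      ext ω
      rw [encard_toENNReal_eq_tsum_indicator]
      rfl
    rw [heq]
    exact Measurable.tsum fun i => measurable_one.indicator (hS i)
  refine measurable_to_countable' fun n => ?_
  convert! h (measurableSet_singleton (n : ℝ≥0∞)) using 1
  ext ω
  simp

/-! ### Mean and generating function of the Poisson law. -/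

theorem lintegral_poissonMeasure (r : ℝ≥0) (f : ℕ → ℝ≥0∞) :
    ∫⁻ n, f n ∂poissonMeasure r =
      ∑' n, ENNReal.ofReal (Real.exp (-r) * r ^ n / n.factorial) * f n := by
  simp [poissonMeasure, lintegral_sum_measure, lintegral_smul_measure]

theorem lintegral_cast_poissonMeasure (r : ℝ≥0) :
    ∫⁻ n, (n : ℝ≥0∞) ∂poissonMeasure r = r := by
  rw [lintegral_poissonMeasure, tsum_eq_zero_add' ENNReal.summable]
  have h : ∀ n : ℕ, ENNReal.ofReal (Real.exp (-r) * r ^ (n + 1) / (n + 1).factorial) *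
      ((n + 1 : ℕ) : ℝ≥0∞) = r * ENNReal.ofReal (Real.exp (-r) * r ^ n / n.factorial) := by
    intro n
    rw [← ENNReal.ofReal_natCast, ← ENNReal.ofReal_mul (by positivity),
      ← ENNReal.ofReal_coe_nnreal, ← ENNReal.ofReal_mul (by positivity)]
    congr 1
    rw [Nat.factorial_succ]
    push_cast
    field_simp
    ring
  simp_rw [h, ENNReal.tsum_mul_left, ← poissonMeasure_singleton]
  have : ∑' n, poissonMeasure r {n} = 1 := by
    rw [← measure_univ (μ := poissonMeasure r), ← lintegral_one, lintegral_poissonMeasure]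
    simp [poissonMeasure_singleton]
  simp [this]

theorem lintegral_pow_poissonMeasure (r : ℝ≥0) {s : ℝ} (hs : 0 ≤ s) :
    ∫⁻ n, ENNReal.ofReal s ^ n ∂poissonMeasure r = ENNReal.ofReal (Real.exp (-r * (1 - s))) := by
  rw [lintegral_poissonMeasure]
  have h := (NormedSpace.expSeries_div_hasSum_exp ((r : ℝ) * s)).mul_left (Real.exp (-r))
  rw [← Real.exp_eq_exp_ℝ, ← Real.exp_add] at h
  have h2 : -(r : ℝ) * (1 - s) = -r + r * s := by ring
  rw [h2, ← h.tsum_eq, ENNReal.ofReal_tsum_of_nonneg (fun n => by positivity) h.summable]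
  refine tsum_congr fun n => ?_
  rw [← ENNReal.ofReal_pow hs, ← ENNReal.ofReal_mul (by positivity)]
  congr 1
  rw [mul_pow]
  ring

/-! ### Counts and intensity measure of a Poisson process. -/

namespace IsPoissonProcess

variable {Ω : Type*} [MeasurableSpace Ω] {P : Measure Ω} {lam : ℝ≥0} {X : ℕ → Ω → Plane}

theorem measurable_count (hX : IsPoissonProcess P lam X) {B : Set Plane} (hB : MeasurableSet B) :
    Measurable fun ω => {i | X i ω ∈ B}.encard :=
  measurable_encard_setOf (S := fun i => X i ⁻¹' B) fun i => hX.measurable i hB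

theorem map_count [IsProbabilityMeasure P] (hX : IsPoissonProcess P lam X) {B : Set Plane}
    (hB : MeasurableSet B) (hvol : volume B ≠ ∞) :
    P.map (fun ω => {i | X i ω ∈ B}.encard) =
      (poissonMeasure (lam * (volume B).toNNReal)).map (Nat.cast : ℕ → ℕ∞) := by
  set N := fun ω => {i | X i ω ∈ B}.encard with hN
  set r := lam * (volume B).toNNReal
  have hNm : Measurable N := hX.measurable_count hB
  have hcm : Measurable (Nat.cast : ℕ → ℕ∞) := .of_discrete
  have hr : ∀ k : ℕ, ((poissonMeasure r).map (Nat.cast : ℕ → ℕ∞)) {(k : ℕ∞)} =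
      poissonMeasure r {k} := by
    intro k
    rw [Measure.map_apply hcm (measurableSet_singleton _)]
    congr 1
    ext j
    simp
  have hl : ∀ k : ℕ, P.map N {(k : ℕ∞)} = poissonMeasure r {k} := by
    intro k
    rw [Measure.map_apply hNm (measurableSet_singleton _)]
    exact hX.poisson B hB hvol k
  have := Measure.isProbabilityMeasure_map (μ := P) hNm.aemeasurable
  have := Measure.isProbabilityMeasure_map (μ := poissonMeasure r) hcm.aemeasurable
  -- The definition prescribes only the probabilities of finite counts; these already sum to one, so
  -- an infinite count is null.
  have key : ∀ μ : Measure ℕ∞, IsProbabilityMeasure μ →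
      (∀ k : ℕ, μ {(k : ℕ∞)} = poissonMeasure r {k}) → μ {⊤} = 0 := by
    intro μ hμ hk
    have hrange : μ (Set.range (Nat.cast : ℕ → ℕ∞)) = 1 := by
      rw [← Set.iUnion_singleton_eq_range, measure_iUnion _ fun _ => measurableSet_singleton _]
      · simp_rw [hk]
        rw [← measure_univ (μ := poissonMeasure r), ← lintegral_one, lintegral_poissonMeasure]
        simp [poissonMeasure_singleton]
      · intro i j hij
        simpa using hij
    have hc : MeasurableSet (Set.range (Nat.cast : ℕ → ℕ∞)) := (Set.countable_range _).measurableSet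
    have h0 := (prob_compl_eq_zero_iff hc).2 hrange
    refine measure_mono_null ?_ h0
    rintro _ rfl ⟨k, hk⟩
    exact ENat.natCast_ne_top k hk
  refine Measure.ext_of_singleton fun n => ?_
  induction n using ENat.recTopCoe with
  | top => rw [key _ inferInstance hl, key _ inferInstance hr]
  | coe k => rw [hl, hr]

theorem lintegral_count [IsProbabilityMeasure P] (hX : IsPoissonProcess P lam X) {B : Set Plane}
    (hB : MeasurableSet B) (hvol : volume B ≠ ∞) (f : ℕ∞ → ℝ≥0∞) :
    ∫⁻ ω, f {i | X i ω ∈ B}.encard ∂P =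
      ∫⁻ n : ℕ, f n ∂poissonMeasure (lam * (volume B).toNNReal) := by
  have hf : Measurable f := .of_discrete
  rw [← lintegral_map (μ := P) hf (hX.measurable_count hB), hX.map_count hB hvol,
    lintegral_map hf .of_discrete]

theorem ae_finite [IsProbabilityMeasure P] (hX : IsPoissonProcess P lam X) {B : Set Plane}
    (hB : MeasurableSet B) (hvol : volume B ≠ ∞) : ∀ᵐ ω ∂P, {i | X i ω ∈ B}.Finite := by
  have h := hX.lintegral_count hB hvol (fun n => (n : ℝ≥0∞))
  simp only [ENat.toENNReal_coe, lintegral_cast_poissonMeasure] at h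
  have hm : Measurable fun ω => ({i | X i ω ∈ B}.encard : ℝ≥0∞) :=
    (Measurable.of_discrete (f := ENat.toENNReal)).comp (hX.measurable_count hB)
  filter_upwards [ae_lt_top hm (h ▸ ENNReal.coe_ne_top)] with ω hω
  simpa [Set.encard_lt_top_iff] using hω

theorem measure_forall_notMem (hX : IsPoissonProcess P lam X) {B : Set Plane}
    (hB : MeasurableSet B) (hvol : volume B ≠ ∞) :
    P {ω | ∀ i, X i ω ∉ B} = ENNReal.ofReal (Real.exp (-(lam * (volume B).toReal))) := by
  have h := hX.poisson B hB hvol 0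
  rw [poissonMeasure_singleton] at h
  convert! h using 2
  · ext ω
    simp [Set.eq_empty_iff_forall_notMem]
  · simp [ENNReal.coe_toNNReal_eq_toReal]

/-- The intensity measure, as needed for Campbell's formula. On sets of finite area it is the
Poisson mean; exhaustion by balls gives the rest. -/
theorem sum_map [IsProbabilityMeasure P] (hX : IsPoissonProcess P lam X) :
    Measure.sum (fun i => P.map (X i)) = lam • (volume : Measure Plane) := by
  have key : ∀ B, MeasurableSet B → volume B ≠ ∞ →
      Measure.sum (fun i => P.map (X i)) B = (lam • (volume : Measure Plane)) B := by
    intro B hB hvol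
    have h := hX.lintegral_count hB hvol (fun n => (n : ℝ≥0∞))
    simp only [ENat.toENNReal_coe, lintegral_cast_poissonMeasure] at h
    rw [Measure.sum_apply _ hB]
    have h2 : ∀ ω, ({i | X i ω ∈ B}.encard : ℝ≥0∞) = ∑' i, (X i ⁻¹' B).indicator 1 ω := by
      intro ω
      rw [encard_toENNReal_eq_tsum_indicator]
      rfl
    simp_rw [h2] at h
    rw [lintegral_tsum fun i => (measurable_one.indicator (hX.measurable i hB)).aemeasurable] at h
    simp_rw [lintegral_indicator_one (hX.measurable _ hB)] at h
    simp_rw [Measure.map_apply (hX.measurable _) hB, h]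
    rw [Measure.smul_apply, ENNReal.coe_mul, ENNReal.coe_toNNReal hvol]
    rfl
  ext B hB
  set S := fun n : ℕ => B ∩ Metric.ball (0 : Plane) n
  have hmono : Monotone S := fun m n hmn =>
    Set.inter_subset_inter_right _ (Metric.ball_subset_ball (by exact_mod_cast hmn))
  have hBS : B = ⋃ n, S n := by
    rw [← Set.inter_iUnion, Metric.iUnion_ball_nat, Set.inter_univ]
  have hS : ∀ n, MeasurableSet (S n) := fun n => hB.inter Metric.isOpen_ball.measurableSet
  rw [hBS, hmono.measure_iUnion, hmono.measure_iUnion]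
  exact iSup_congr fun n => key _ (hS n) (ne_top_of_le_ne_top measure_ball_lt_top.ne
    (measure_mono Set.inter_subset_right))

end IsPoissonProcess

/-! ### Probability generating functional. -/

theorem iInf_prod_range_eq_prod_of_le_one {f : ℕ → ℝ≥0∞} (hf : ∀ i, f i ≤ 1) (F : Finset ℕ)
    (hF : ∀ i ∉ F, f i = 1) : ⨅ n, ∏ i ∈ Finset.range n, f i = ∏ i ∈ F, f i := by
  refine le_antisymm ?_ (le_iInf fun n => ?_)
  · obtain ⟨n, hn⟩ := F.exists_nat_subset_range
    refine (iInf_le _ n).trans_eq ?_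
    exact (Finset.prod_subset hn fun i _ hi => hF i hi).symm
  · calc ∏ i ∈ F, f i = ∏ i ∈ F ∪ Finset.range n, f i :=
          Finset.prod_subset Finset.subset_union_left fun i _ hi => hF i hi
      _ ≤ ∏ i ∈ Finset.range n, f i :=
          Finset.prod_le_prod_of_subset_of_le_one' Finset.subset_union_right fun i _ _ => hf i

namespace IsPoissonProcess

variable {Ω : Type*} [MeasurableSpace Ω] {P : Measure Ω} [IsProbabilityMeasure P] {lam : ℝ≥0}
  {X : ℕ → Ω → Plane}

/-- For a step function the product groups by level set into powers `s j ^ N j`, where the counts `N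
j` are independent and Poisson. The infimum of the partial products serves as the infinite product,
since all factors are at most one. -/
theorem lintegral_iInf_prod_of_fintype_range (hX : IsPoissonProcess P lam X) {K : Set Plane}
    (hK : MeasurableSet K) (hvol : volume K ≠ ∞) {m : ℕ} {k : Plane → Fin m} (hk : Measurable k)
    {s : Fin m → ℝ} (hs0 : ∀ j, 0 ≤ s j) (hs1 : ∀ j, s j ≤ 1) {g : Plane → ℝ}
    (hg : ∀ t ∈ K, g t = s (k t)) (hg1 : ∀ t ∉ K, g t = 1) :
    ∫⁻ ω, ⨅ n, ∏ i ∈ Finset.range n, ENNReal.ofReal (g (X i ω)) ∂P =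
      ENNReal.ofReal (Real.exp (-(lam * ∫ t in K, (1 - g t)))) := by
  classical
  set B : Fin m → Set Plane := fun j => K ∩ k ⁻¹' {j} with hBdef
  have hB : ∀ j, MeasurableSet (B j) := fun j => hK.inter (hk (measurableSet_singleton j))
  have hBvol : ∀ j, volume (B j) ≠ ∞ := fun j =>
    ne_top_of_le_ne_top hvol (measure_mono Set.inter_subset_left)
  have hdisj : Pairwise fun i j => Disjoint (B i) (B j) := by
    intro i j hij
    rw [Set.disjoint_left]
    rintro t ⟨_, h1⟩ ⟨_, h2⟩
    exact hij (h1.symm.trans h2)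
  have hind := hX.indep m B hB hdisj
  have hgle : ∀ t, g t ≤ 1 := by
    intro t
    by_cases ht : t ∈ K
    · rw [hg t ht]; exact hs1 _
    · rw [hg1 t ht]
  have hae : ∀ᵐ ω ∂P, ⨅ n, ∏ i ∈ Finset.range n, ENNReal.ofReal (g (X i ω)) =
      ∏ j, ENNReal.ofReal (s j) ^ ({i | X i ω ∈ B j}.encard).toNat := by
    filter_upwards [hX.ae_finite hK hvol] with ω hω
    rw [iInf_prod_range_eq_prod_of_le_one (fun i => ENNReal.ofReal_le_one.2 (hgle _)) hω.toFinset]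
    · rw [← Finset.prod_fiberwise hω.toFinset (fun i => k (X i ω))]
      refine Finset.prod_congr rfl fun j _ => ?_
      have h1 : ∀ i ∈ hω.toFinset.filter fun i => k (X i ω) = j,
          ENNReal.ofReal (g (X i ω)) = ENNReal.ofReal (s j) := by
        intro i hi
        simp only [Finset.mem_filter, Set.Finite.mem_toFinset, Set.mem_ofPred_eq] at hi
        rw [hg _ hi.1, hi.2]
      rw [Finset.prod_congr rfl h1, Finset.prod_const]
      congr 1
      have h2 : {i | X i ω ∈ B j} = ↑(hω.toFinset.filter fun i => k (X i ω) = j) := by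
        ext i
        simp [hBdef]
      rw [h2, Set.encard_coe_eq_coe_finsetCard, ENat.toNat_natCast]
    · intro i hi
      rw [hg1 _ (by simpa using hi), ENNReal.ofReal_one]
  rw [lintegral_congr_ae hae]
  have hind2 := hind.comp (fun j n => ENNReal.ofReal (s j) ^ n.toNat) fun j => .of_discrete
  have h3 := lintegral_prod_eq_prod_lintegral_of_indepFun Finset.univ _ hind2
    fun j => (Measurable.of_discrete (f := fun n : ℕ∞ => ENNReal.ofReal (s j) ^ n.toNat)).comp
      (hX.measurable_count (hB j))
  simp only [Function.comp_apply] at h3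
  rw [h3]
  have h4 : ∀ j, ∫⁻ ω, ENNReal.ofReal (s j) ^ ({i | X i ω ∈ B j}.encard).toNat ∂P =
      ENNReal.ofReal (Real.exp (-(lam * (volume.real (B j) * (1 - s j))))) := by
    intro j
    rw [hX.lintegral_count (hB j) (hBvol j) (fun n => ENNReal.ofReal (s j) ^ n.toNat)]
    simp only [ENat.toNat_natCast]
    rw [lintegral_pow_poissonMeasure _ (hs0 j)]
    congr 2
    rw [measureReal_def, NNReal.coe_mul, ENNReal.coe_toNNReal_eq_toReal]
    ring
  simp_rw [h4]
  rw [← ENNReal.ofReal_prod_of_nonneg fun _ _ => (Real.exp_pos _).le, ← Real.exp_sum]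
  congr 2
  rw [Finset.sum_neg_distrib, ← Finset.mul_sum]
  congr 2
  have hfin : IsFiniteMeasure (volume.restrict K) := ⟨by simpa using hvol.lt_top⟩
  have h5 : ∫ t in K, (1 - g t) = ∫ t in K, (fun j => 1 - s j) (k t) :=
    setIntegral_congr_fun hK fun t ht => by simp [hg t ht]
  rw [h5, ← integral_map (μ := volume.restrict K) (f := fun j => 1 - s j) hk.aemeasurable
    .of_discrete, integral_fintype .of_finite]
  refine Finset.sum_congr rfl fun j _ => ?_
  rw [smul_eq_mul, measureReal_def, measureReal_def, Measure.map_apply hk (measurableSet_singleton j),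
    Measure.restrict_apply (hk (measurableSet_singleton j)), Set.inter_comm]

/-- The probability generating functional of a Poisson process. -/
theorem lintegral_iInf_prod (hX : IsPoissonProcess P lam X) {K : Set Plane}
    (hK : MeasurableSet K) (hvol : volume K ≠ ∞) {q : Plane → ℝ} (hq : Measurable q)
    (hq0 : ∀ t, 0 ≤ q t) (hq1 : ∀ t, q t ≤ 1) (hqK : ∀ t ∉ K, q t = 1) :
    ∫⁻ ω, ⨅ n, ∏ i ∈ Finset.range n, ENNReal.ofReal (q (X i ω)) ∂P =
      ENNReal.ofReal (Real.exp (-(lam * ∫ t in K, (1 - q t)))) := by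
  classical
  set I := ∫ t in K, (1 - q t)
  have hfin : IsFiniteMeasure (volume.restrict K) := ⟨by simpa using hvol.lt_top⟩
  have hintb : ∀ f : Plane → ℝ, Measurable f → (∀ t, |f t| ≤ 2) →
      Integrable f (volume.restrict K) := fun f hf hb =>
    Integrable.of_bound hf.aestronglyMeasurable 2 (ae_of_all _ hb)
  have hmono : ∀ f g : Plane → ℝ, (∀ t, f t ≤ g t) →
      ∫⁻ ω, ⨅ n, ∏ i ∈ Finset.range n, ENNReal.ofReal (f (X i ω)) ∂P ≤
      ∫⁻ ω, ⨅ n, ∏ i ∈ Finset.range n, ENNReal.ofReal (g (X i ω)) ∂P := fun f g hfg =>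
    lintegral_mono fun ω => iInf_mono fun n =>
      Finset.prod_le_prod' fun i _ => ENNReal.ofReal_le_ofReal (hfg _)
  -- Squeeze `q` between two step functions within `1 / (n + 1)` of it; the functional is monotone
  -- in `q`.
  have hbounds : ∀ n : ℕ,
      ENNReal.ofReal (Real.exp (-(lam * (I + volume.real K * (1 / ((n : ℝ) + 1)))))) ≤
        ∫⁻ ω, ⨅ n, ∏ i ∈ Finset.range n, ENNReal.ofReal (q (X i ω)) ∂P ∧
      ∫⁻ ω, ⨅ n, ∏ i ∈ Finset.range n, ENNReal.ofReal (q (X i ω)) ∂P ≤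
        ENNReal.ofReal (Real.exp (-(lam * (I - volume.real K * (1 / ((n : ℝ) + 1)))))) := by
    intro n
    set N : ℝ := (n : ℝ) + 1 with hN
    have hNpos : 0 < N := by positivity
    have hlt : ∀ t, ⌊N * q t⌋₊ < n + 2 := by
      intro t
      rw [Nat.floor_lt (mul_nonneg hNpos.le (hq0 t))]
      push_cast
      nlinarith [hq1 t]
    -- There are `n + 2` levels because `q t = 1` reaches level `N = n + 1`; the caps at one below
    -- keep the upper values admissible there.
    set k : Plane → Fin (n + 2) := fun t => ⟨⌊N * q t⌋₊, hlt t⟩ with hkdef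
    have hk : Measurable k := by
      have h0 : Measurable fun t => ⌊N * q t⌋₊ := Nat.measurable_floor.comp (hq.const_mul N)
      refine measurable_to_countable' fun j => ?_
      convert! h0 (measurableSet_singleton (j : ℕ)) using 1
      ext t
      simp [hkdef, Fin.ext_iff]
    set lo : Fin (n + 2) → ℝ := fun j => min 1 ((j : ℕ) / N)
    set hi : Fin (n + 2) → ℝ := fun j => min 1 (((j : ℕ) + 1) / N)
    set gl : Plane → ℝ := fun t => if t ∈ K then lo (k t) else 1 with hgl
    set gh : Plane → ℝ := fun t => if t ∈ K then hi (k t) else 1 with hgh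
    have hlo0 : ∀ j, 0 ≤ lo j := fun j => le_min zero_le_one (by positivity)
    have hhi0 : ∀ j, 0 ≤ hi j := fun j => le_min zero_le_one (by positivity)
    have hlo1 : ∀ j, lo j ≤ 1 := fun j => min_le_left _ _
    have hhi1 : ∀ j, hi j ≤ 1 := fun j => min_le_left _ _
    have hfl : ∀ t, ((⌊N * q t⌋₊ : ℕ) : ℝ) / N ≤ q t := fun t => by
      rw [div_le_iff₀ hNpos, mul_comm (q t)]
      exact Nat.floor_le (mul_nonneg hNpos.le (hq0 t))
    have hfu : ∀ t, q t ≤ ((⌊N * q t⌋₊ : ℕ) + 1 : ℝ) / N := fun t => by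
      rw [le_div_iff₀ hNpos, mul_comm]
      exact (Nat.lt_floor_add_one _).le
    have hle : ∀ t, gl t ≤ q t := by
      intro t
      by_cases ht : t ∈ K
      · simp only [hgl, ht, if_true]
        exact (min_le_right _ _).trans (hfl t)
      · simp only [hgl, ht, if_false, hqK t ht, le_refl]
    have hge : ∀ t, q t ≤ gh t := by
      intro t
      by_cases ht : t ∈ K
      · simp only [hgh, ht, if_true]
        exact le_min (hq1 t) (hfu t)
      · simp only [hgh, ht, if_false, hqK t ht, le_refl]
    have hadd : ∀ t, ((⌊N * q t⌋₊ : ℕ) + 1 : ℝ) / N = (⌊N * q t⌋₊ : ℕ) / N + 1 / N := fun t =>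
      add_div _ _ _
    have hgll : ∀ t, q t - 1 / N ≤ gl t := by
      intro t
      have hN1 : 0 < 1 / N := by positivity
      by_cases ht : t ∈ K
      · simp only [hgl, ht, if_true]
        exact le_min (by linarith [hq1 t]) (by
          have := hfu t
          rw [hadd] at this
          simp only [hkdef]
          linarith)
      · simp only [hgl, ht, if_false]
        linarith [hq1 t]
    have hghl : ∀ t, gh t ≤ q t + 1 / N := by
      intro t
      have hN1 : 0 < 1 / N := by positivity
      by_cases ht : t ∈ K
      · simp only [hgh, ht, if_true]
        refine (min_le_right _ _).trans ?_
        simp only [hkdef]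
        rw [hadd]
        linarith [hfl t]
      · simp only [hgh, ht, if_false, hqK t ht]
        linarith
    have hglm : Measurable gl :=
      Measurable.ite hK ((Measurable.of_discrete (f := lo)).comp hk) measurable_const
    have hghm : Measurable gh :=
      Measurable.ite hK ((Measurable.of_discrete (f := hi)).comp hk) measurable_const
    have hgl0 : ∀ t, 0 ≤ gl t := fun t => by
      simp only [hgl]; split_ifs <;> simp [hlo0]
    have hgh1 : ∀ t, gh t ≤ 1 := fun t => by
      simp only [hgh]; split_ifs <;> simp [hhi1]
    have hN1 : 1 / N ≤ 1 := by
      rw [div_le_one hNpos]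
      simp [hN]
    have hN0 : 0 < 1 / N := by positivity
    have hconst : ∫ _ in K, (1 / N) = volume.real K * (1 / N) := by
      simp
    have hIint : Integrable (fun t => 1 - q t) (volume.restrict K) :=
      hintb _ (measurable_const.sub hq) fun t =>
        abs_le.2 ⟨by linarith [hq1 t], by linarith [hq0 t]⟩
    have hIl : ∫ t in K, (1 - gl t) ≤ I + volume.real K * (1 / N) := by
      rw [← hconst, ← integral_add hIint (integrable_const _)]
      refine integral_mono (hintb _ (measurable_const.sub hglm) fun t => ?_)
        (hIint.add (integrable_const _)) fun t => ?_
      · exact abs_le.2 ⟨by linarith [hle t, hq1 t], by linarith [hgl0 t]⟩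
      · have := hgll t
        simp only
        linarith
    have hIh : I - volume.real K * (1 / N) ≤ ∫ t in K, (1 - gh t) := by
      rw [← hconst, ← integral_sub hIint (integrable_const _)]
      refine integral_mono (hIint.sub (integrable_const _))
        (hintb _ (measurable_const.sub hghm) fun t => ?_) fun t => ?_
      · exact abs_le.2 ⟨by linarith [hgh1 t], by linarith [hge t, hq0 t]⟩
      · have := hghl t
        simp only
        linarith
    constructor
    · refine le_trans ?_ (hmono gl q hle)
      rw [hX.lintegral_iInf_prod_of_fintype_range hK hvol hk hlo0 hlo1 (g := gl)
        (fun t ht => by simp [hgl, ht]) (fun t ht => by simp [hgl, ht])]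
      exact ENNReal.ofReal_le_ofReal (Real.exp_le_exp.2 (neg_le_neg
        (mul_le_mul_of_nonneg_left hIl lam.coe_nonneg)))
    · refine (hmono q gh hge).trans ?_
      rw [hX.lintegral_iInf_prod_of_fintype_range hK hvol hk hhi0 hhi1 (g := gh)
        (fun t ht => by simp [hgh, ht]) (fun t ht => by simp [hgh, ht])]
      exact ENNReal.ofReal_le_ofReal (Real.exp_le_exp.2 (neg_le_neg
        (mul_le_mul_of_nonneg_left hIh lam.coe_nonneg)))
  have hlim : Tendsto (fun n : ℕ => volume.real K * (1 / ((n : ℝ) + 1))) atTop (nhds 0) := by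
    simpa using tendsto_one_div_add_atTop_nhds_zero_nat.const_mul (volume.real K)
  have hcont : Continuous fun x : ℝ => ENNReal.ofReal (Real.exp (-(lam * x))) :=
    ENNReal.continuous_ofReal.comp (by fun_prop)
  refine le_antisymm ?_ ?_
  · refine ge_of_tendsto' (x := atTop) ?_ fun n => (hbounds n).2
    refine (hcont.tendsto I).comp ?_
    simpa using tendsto_const_nhds.sub hlim
  · refine le_of_tendsto' (x := atTop) ?_ fun n => (hbounds n).1
    refine (hcont.tendsto I).comp ?_
    simpa using tendsto_const_nhds.add hlim

end IsPoissonProcess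

/-! ### Displacement theorem for the receivers. -/

namespace IsPrimaryNetwork

variable {Ω : Type*} [MeasurableSpace Ω] {P : Measure Ω} {lamPT : ℝ≥0}
  {Rp : ℝ} {T V : ℕ → Ω → Plane}

theorem measurable_displacement (h : IsPrimaryNetwork P lamPT Rp T V) (i : ℕ) :
    Measurable fun ω => V i ω - T i ω :=
  (h.receiver_measurable i).sub (h.transmitters.measurable i)

/-- Given all transmitters, the displacements are still independent and uniform, so the conditional
probability factorizes. -/
theorem measure_forall_lt_notMem [IsProbabilityMeasure P]
    (h : IsPrimaryNetwork P lamPT Rp T V) {C : Set Plane}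
    (hC : MeasurableSet C) (n : ℕ) :
    P {ω | ∀ i ∈ Finset.range n, V i ω ∉ C} = ∫⁻ ω, ∏ i ∈ Finset.range n,
      cond volume (Metric.closedBall (0 : Plane) Rp) {d | T i ω + d ∉ C} ∂P := by
  set ν := cond volume (Metric.closedBall (0 : Plane) Rp)
  have hTm : Measurable fun ω i => T i ω := measurable_pi_lambda _ h.transmitters.measurable
  have hDm : Measurable fun ω i => V i ω - T i ω := measurable_pi_lambda _ h.measurable_displacement
  set S : Set ((ℕ → Plane) × (ℕ → Plane)) := {z | ∀ i ∈ Finset.range n, z.1 i + z.2 i ∉ C}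
  have hS : MeasurableSet S := by
    have : S = ⋂ i ∈ Finset.range n,
        (fun z : (ℕ → Plane) × (ℕ → Plane) => z.1 i + z.2 i) ⁻¹' Cᶜ := by
      ext z
      simp [S]
    rw [this]
    refine Finset.measurableSet_biInter _ fun i _ => ?_
    exact (((measurable_pi_apply i).comp measurable_fst).add
      ((measurable_pi_apply i).comp measurable_snd)) hC.compl
  have hpair := (indepFun_iff_map_prod_eq_prod_map_map hTm.aemeasurable hDm.aemeasurable).1
    h.indep_transmitters
  have := Measure.isProbabilityMeasure_map (μ := P) hTm.aemeasurable
  have := Measure.isProbabilityMeasure_map (μ := P) hDm.aemeasurable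
  have h1 : P {ω | ∀ i ∈ Finset.range n, V i ω ∉ C} =
      P.map (fun ω => ((fun i => T i ω), (fun i => V i ω - T i ω))) S := by
    rw [Measure.map_apply (hTm.prodMk hDm) hS]
    congr 1
    ext ω
    simp [S]
  rw [h1, hpair, Measure.prod_apply hS,
    lintegral_map (measurable_measure_prodMk_left hS) hTm]
  refine lintegral_congr fun ω => ?_
  rw [Measure.map_apply hDm (measurable_prodMk_left hS)]
  have hsets : ∀ i, MeasurableSet {d : Plane | T i ω + d ∉ C} := fun i =>
    (measurable_const_add (T i ω)) hC.compl
  have h2 := h.displacements_indep.measure_inter_preimage_eq_mul (Finset.range n)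
    (sets := fun i => {d : Plane | T i ω + d ∉ C}) fun i _ => hsets i
  have h3 : ∀ i, P ((fun ω' => V i ω' - T i ω') ⁻¹' {d : Plane | T i ω + d ∉ C}) =
      ν {d | T i ω + d ∉ C} := by
    intro i
    rw [← Measure.map_apply (h.measurable_displacement i) (hsets i), h.uniform i]
  simp_rw [h3] at h2
  rw [← h2]
  congr 1
  ext ω'
  simp [S]

/-- The void probabilities of the receivers are those of a Poisson process of density `lamPT`. -/
theorem measure_forall_receiver_notMem [IsProbabilityMeasure P]
    (h : IsPrimaryNetwork P lamPT Rp T V) (hRp : 0 < Rp) {C : Set Plane}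
    (hC : MeasurableSet C) (hCb : Bornology.IsBounded C) :
    P {ω | ∀ i, V i ω ∉ C} = ENNReal.ofReal (Real.exp (-(lamPT * (volume C).toReal))) := by
  set D := Metric.closedBall (0 : Plane) Rp
  set ν := cond volume D with hν
  have hD0 : volume D ≠ 0 := (Metric.measure_closedBall_pos volume 0 hRp).ne'
  have hDt : volume D ≠ ∞ := measure_closedBall_lt_top.ne
  have hνp : IsProbabilityMeasure ν := cond_isProbabilityMeasure_of_finite hD0 hDt
  set S : Set (Plane × Plane) := {z | z.1 + z.2 ∈ C}
  have hS : MeasurableSet S := (measurable_fst.add measurable_snd) hC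
  set p : Plane → ℝ≥0∞ := fun t => ν {d | t + d ∈ C} with hp
  have hpm : Measurable p := measurable_measure_prodMk_left hS
  have hp1 : ∀ t, p t ≤ 1 := fun t => prob_le_one
  have hptop : ∀ t, p t ≠ ∞ := fun t => ((hp1 t).trans_lt ENNReal.one_lt_top).ne
  obtain ⟨R, hR⟩ := hCb.subset_closedBall (0 : Plane)
  -- Only transmitters in `K` can have a receiver in `C`, so the generating functional is needed
  -- only for a function equal to one off a set of finite area.
  set K := Metric.closedBall (0 : Plane) (R + Rp)
  have hK : MeasurableSet K := Metric.isClosed_closedBall.measurableSet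
  have hpK : ∀ t ∉ K, p t = 0 := by
    intro t ht
    have hDm : MeasurableSet D := Metric.isClosed_closedBall.measurableSet
    rw [hp, hν]
    simp only
    rw [cond_apply hDm]
    have : D ∩ {d | t + d ∈ C} = ∅ := by
      rw [Set.eq_empty_iff_forall_notMem]
      rintro d ⟨hd, hdC⟩
      have h1 := hR hdC
      simp only [D, K, mem_closedBall_zero_iff] at h1 hd ht
      apply ht
      calc ‖t‖ = ‖(t + d) - d‖ := by simp
        _ ≤ ‖t + d‖ + ‖d‖ := norm_sub_le _ _
        _ ≤ R + Rp := add_le_add h1 hd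
    rw [this, measure_empty, mul_zero]
  set q : Plane → ℝ := fun t => 1 - (p t).toReal with hq
  have hqm : Measurable q := measurable_const.sub hpm.ennreal_toReal
  have hpr1 : ∀ t, (p t).toReal ≤ 1 := fun t => ENNReal.toReal_le_of_le_ofReal zero_le_one
    (by simpa using hp1 t)
  have hcompl : ∀ t, ν {d | t + d ∉ C} = ENNReal.ofReal (q t) := by
    intro t
    have hm : MeasurableSet {d : Plane | t + d ∈ C} := (measurable_const_add t) hC
    have := prob_compl_eq_one_sub (μ := ν) hm
    rw [ENNReal.ofReal_sub _ ENNReal.toReal_nonneg, ENNReal.ofReal_toReal (hptop t),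
      ENNReal.ofReal_one, ← this]
    rfl
  have hgen := h.transmitters.lintegral_iInf_prod hK measure_closedBall_lt_top.ne hqm
    (fun t => sub_nonneg.2 (hpr1 t)) (fun t => sub_le_self _ ENNReal.toReal_nonneg)
    (fun t ht => by simp [hq, hpK t ht])
  -- By Tonelli and translation invariance, averaging over displacements preserves Lebesgue measure.
  have hI : ∫ t in K, (1 - q t) = (volume C).toReal := by
    simp only [hq, sub_sub_cancel]
    rw [integral_toReal hpm.aemeasurable.restrict (ae_of_all _ fun t => (hptop t).lt_top)]
    congr 1
    rw [setLIntegral_eq_of_support_subset (fun t ht => by_contra fun h0 => ht (hpK t h0))]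
    calc ∫⁻ t, p t = (volume.prod ν) S := (Measure.prod_apply hS).symm
      _ = ∫⁻ d, volume ((fun t => (t, d)) ⁻¹' S) ∂ν := Measure.prod_apply_symm hS
      _ = ∫⁻ _, volume C ∂ν := lintegral_congr fun d => measure_preimage_add_right volume d C
      _ = volume C := by simp
  rw [hI] at hgen
  rw [← hgen]
  -- Pass from finitely many receivers to all: continuity from above on the left, monotone
  -- convergence for the partial products on the right.
  have hanti : Antitone fun n => {ω | ∀ i ∈ Finset.range n, V i ω ∉ C} := by
    intro m n hmn ω hω i hi
    exact hω i (Finset.range_mono hmn hi)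
  have hset : {ω | ∀ i, V i ω ∉ C} = ⋂ n, {ω | ∀ i ∈ Finset.range n, V i ω ∉ C} := by
    ext ω
    simp only [Set.mem_ofPred_eq, Set.mem_iInter, Finset.mem_range]
    exact ⟨fun hω n i _ => hω i, fun hω i => hω (i + 1) i (Nat.lt_succ_self i)⟩
  have hmeas : ∀ n, MeasurableSet {ω | ∀ i ∈ Finset.range n, V i ω ∉ C} := by
    intro n
    have : {ω | ∀ i ∈ Finset.range n, V i ω ∉ C} = ⋂ i ∈ Finset.range n, V i ⁻¹' Cᶜ := by
      ext ω
      simp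
    rw [this]
    exact Finset.measurableSet_biInter _ fun i _ => h.receiver_measurable i hC.compl
  rw [hset, hanti.measure_iInter (fun n => (hmeas n).nullMeasurableSet)
    ⟨0, measure_ne_top _ _⟩]
  simp_rw [h.measure_forall_lt_notMem hC]
  rw [lintegral_iInf]
  · refine iInf_congr fun n => lintegral_congr fun ω => Finset.prod_congr rfl fun i _ => hcompl _
  · intro n
    refine Finset.measurable_prod _ fun i _ => ?_
    exact ENNReal.measurable_ofReal.comp (hqm.comp (h.transmitters.measurable i))
  · intro m n hmn ω
    refine Finset.prod_le_prod_of_subset_of_le_one' (Finset.range_mono hmn) fun i _ _ => ?_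
    exact ENNReal.ofReal_le_one.2 (sub_le_self _ ENNReal.toReal_nonneg)
  · simp

end IsPrimaryNetwork

/-! ### Crescent area and the exponential integral. -/

/-- The crescent contains the region swept by the arc of the upper semicircle over `|re| ≤ r / 2`
when it is raised by `d`: a region of width `r` and vertical thickness `d`. Over that strip the
semicircle has height at least `√3 / 2 * r ≥ d / 2`, which keeps the region above the lower arc of
the shifted disk. -/
theorem Complex.ofReal_mul_le_volume_closedBall_diff {r d : ℝ} (hr : 0 ≤ r) (hd : 0 ≤ d)
    (hdr : d ≤ r) :
    ENNReal.ofReal (r * d) ≤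
      volume (Metric.closedBall (d * Complex.I) r \ Metric.closedBall (0 : ℂ) r) := by
  set f : ℝ → ℝ := fun y => √(r ^ 2 - y ^ 2) with hf
  have hfm : Measurable f := by fun_prop
  have hreg : (volume : Measure (ℝ × ℝ)) (regionBetween f (fun y => f y + d)
      (Set.Icc (-(r / 2)) (r / 2))) = ENNReal.ofReal (r * d) := by
    rw [Measure.volume_eq_prod, volume_regionBetween_eq_lintegral hfm.aemeasurable
      (hfm.add_const d).aemeasurable measurableSet_Icc]
    simp only [Pi.sub_apply, add_sub_cancel_left, lintegral_const, Measure.restrict_apply,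
      MeasurableSet.univ, Set.univ_inter, Real.volume_Icc]
    rw [← ENNReal.ofReal_mul hd]
    congr 1
    ring
  rw [← hreg, ← Complex.volume_preserving_equiv_real_prod.measure_preimage_equiv]
  refine measure_mono ?_
  rintro z ⟨⟨h1, h2⟩, h3, h4⟩
  simp only [Complex.measurableEquivRealProd_apply] at h1 h2 h3 h4
  have hz2 : z.re ^ 2 ≤ r ^ 2 / 4 := by nlinarith
  have hs : f z.re ^ 2 = r ^ 2 - z.re ^ 2 := Real.sq_sqrt (by nlinarith)
  have hs0 : 0 ≤ f z.re := Real.sqrt_nonneg _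
  have hsd : d ≤ 2 * f z.re := by
    refine le_of_sq_le_sq ?_ (by positivity)
    nlinarith
  constructor
  · rw [Metric.mem_closedBall, Complex.dist_eq_re_im]
    refine Real.sqrt_le_iff.2 ⟨hr, ?_⟩
    simp
    nlinarith
  · rw [Metric.mem_closedBall, Complex.dist_eq_re_im, not_le]
    refine Real.lt_sqrt_of_sq_lt ?_
    simp
    nlinarith

theorem exists_linearIsometryEquiv_complex (v : Plane) :
    ∃ φ : ℂ ≃ₗᵢ[ℝ] Plane, φ (‖v‖ * Complex.I) = v := by
  set ψ : ℂ ≃ₗᵢ[ℝ] Plane := Complex.orthonormalBasisOneI.repr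
  set w := ψ.symm v with hw
  have hwv : ‖w‖ = ‖v‖ := ψ.symm.norm_map v
  by_cases h0 : w = 0
  · refine ⟨ψ, ?_⟩
    have hv : v = 0 := by rw [← norm_eq_zero, ← hwv, h0, norm_zero]
    simp [hv]
  · have hn : (‖w‖ : ℂ) ≠ 0 := by simpa using h0
    set u : Circle := ⟨w / (‖w‖ * Complex.I), mem_sphere_zero_iff_norm.2 (by simp [h0])⟩ with hu
    refine ⟨(rotation u).trans ψ, ?_⟩
    have h1 : rotation u (‖v‖ * Complex.I) = w := by
      rw [rotation_apply, ← hwv]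
      exact div_mul_cancel₀ w (mul_ne_zero hn Complex.I_ne_zero)
    rw [LinearIsometryEquiv.trans_apply, h1, hw, ψ.apply_symm_apply]

theorem ofReal_mul_dist_le_volume_closedBall_diff {r : ℝ} (hr : 0 ≤ r) {x a : Plane}
    (h : dist x a ≤ r) : ENNReal.ofReal (r * dist x a) ≤
      volume (Metric.closedBall x r \ Metric.closedBall a r) := by
  obtain ⟨φ, hφ⟩ := exists_linearIsometryEquiv_complex (x - a)
  refine (Complex.ofReal_mul_le_volume_closedBall_diff hr dist_nonneg h).trans ?_
  have hmp : MeasurePreserving (fun z => φ z + a) (volume : Measure ℂ) volume :=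
    (measurePreserving_add_right volume a).comp φ.measurePreserving
  rw [← hmp.measure_preimage (Metric.isClosed_closedBall.measurableSet.diff
    Metric.isClosed_closedBall.measurableSet).nullMeasurableSet]
  refine measure_mono ?_
  have hdist : ∀ z w : ℂ, dist (φ z + a) (φ w + a) = dist z w := by simp
  have hx : φ (dist x a * Complex.I) + a = x := by rw [dist_eq_norm, hφ, sub_add_cancel]
  have ha : φ 0 + a = a := by simp
  rintro z ⟨h1, h2⟩
  simp only [Set.mem_preimage, Set.mem_sdiff, Metric.mem_closedBall] at *
  constructor
  · rw [← hx, hdist]; exact h1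
  · have := hdist z 0
    rw [ha] at this
    rwa [this]

theorem lintegral_exp_neg_mul_dist {b : ℝ} (hb : 0 < b) (a : Plane) :
    ∫⁻ x : Plane, ENNReal.ofReal (Real.exp (-(b * dist x a))) =
      ENNReal.ofReal (2 * Real.pi / b ^ 2) := by
  have h := Complex.integral_exp_neg_mul_rpow (p := 1) le_rfl hb
  simp only [Real.rpow_one] at h
  have hval : Real.pi * b ^ (-(2 : ℝ) / 1) * Real.Gamma (2 / 1 + 1) = 2 * Real.pi / b ^ 2 := by
    rw [div_one, div_one, show (2 : ℝ) + 1 = ((2 : ℕ) : ℝ) + 1 by norm_num,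
      Real.Gamma_nat_eq_factorial, Real.rpow_neg hb.le]
    norm_num
    ring
  rw [hval] at h
  have hint : Integrable fun x : ℂ => Real.exp (-b * ‖x‖) := by
    -- A non-integrable function would have integral zero by convention, but the known value is
    -- positive.
    by_contra hn
    rw [integral_undef hn] at h
    have : 0 < 2 * Real.pi / b ^ 2 := by positivity
    linarith
  have hl := ofReal_integral_eq_lintegral_ofReal hint (ae_of_all _ fun x => (Real.exp_pos _).le)
  rw [h] at hl
  rw [hl]
  set ψ : ℂ ≃ₗᵢ[ℝ] Plane := Complex.orthonormalBasisOneI.repr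
  have hmp : MeasurePreserving (fun z => ψ z + a) (volume : Measure ℂ) volume :=
    (measurePreserving_add_right volume a).comp ψ.measurePreserving
  rw [← hmp.lintegral_comp (by fun_prop)]
  simp [dist_eq_norm]

/-! ### Opportunity events. -/

theorem seesOpportunity_iff {rI RI : ℝ} {t v : ℕ → Plane} {x : Plane} :
    SeesOpportunity rI RI t v x ↔ ∀ i, rI < dist x (v i) ∧ RI < dist x (t i) := by
  simp [SeesOpportunity, HasPointWithin, forall_and]

theorem measurableSet_seesOpportunity (rI RI : ℝ) :
    MeasurableSet {z : ((ℕ → Plane) × (ℕ → Plane)) × Plane |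
      SeesOpportunity rI RI z.1.1 z.1.2 z.2} := by
  simp_rw [seesOpportunity_iff, Set.ofPred_forall, Set.ofPred_and]
  refine MeasurableSet.iInter fun i => MeasurableSet.inter ?_ ?_
  · exact measurableSet_lt measurable_const (measurable_snd.dist
      ((measurable_pi_apply i).comp (measurable_snd.comp measurable_fst)))
  · exact measurableSet_lt measurable_const (measurable_snd.dist
      ((measurable_pi_apply i).comp (measurable_fst.comp measurable_fst)))

theorem userDegree_toENNReal_eq_tsum (rp rI RI : ℝ) (t v u : ℕ → Plane) (a : Plane) :
    (userDegree rp rI RI t v u a : ℝ≥0∞) = ∑' i, {i | u i ∈ Metric.closedBall a rp ∧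
      SeesOpportunity rI RI t v a ∧ SeesOpportunity rI RI t v (u i)}.indicator 1 i := by
  rw [← encard_toENNReal_eq_tsum_indicator, userDegree,
    ← Function.Injective.encard_image (Option.some_injective ℕ)]
  congr 2
  ext j
  cases j with
  | none => simp
  | some i => simp [secondaryGraph, addUser, dist_comm]

namespace IsPrimaryNetwork

variable {Ω : Type*} [MeasurableSpace Ω] {P : Measure Ω} {lamPT : ℝ≥0} {Rp : ℝ}
  {T V : ℕ → Ω → Plane}

theorem measurable_pair (h : IsPrimaryNetwork P lamPT Rp T V) :
    Measurable fun ω => ((fun i => T i ω), (fun i => V i ω)) :=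
  (measurable_pi_lambda _ h.transmitters.measurable).prodMk
    (measurable_pi_lambda _ h.receiver_measurable)

theorem measurableSet_opportunityEvent (h : IsPrimaryNetwork P lamPT Rp T V) (rI RI : ℝ)
    (x : Plane) : MeasurableSet (opportunityEvent rI RI T V x) :=
  (h.measurable_pair.prodMk measurable_const) (measurableSet_seesOpportunity rI RI)

theorem ae_dist_receiver_le (h : IsPrimaryNetwork P lamPT Rp T V) :
    ∀ᵐ ω ∂P, ∀ i, dist (V i ω) (T i ω) ≤ Rp := by
  rw [ae_all_iff]
  intro i
  have h1 : ∀ᵐ d ∂(P.map fun ω => V i ω - T i ω), d ∈ Metric.closedBall (0 : Plane) Rp := by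
    rw [h.uniform i]
    exact ae_cond_mem Metric.isClosed_closedBall.measurableSet
  filter_upwards [ae_of_ae_map (h.measurable_displacement i).aemeasurable h1] with ω hω
  simpa [dist_eq_norm] using hω

theorem measure_opportunityEvent_pos (h : IsPrimaryNetwork P lamPT Rp T V)
    (rI RI : ℝ) (a : Plane) : 0 < P (opportunityEvent rI RI T V a) := by
  -- If this disk has no transmitter, then almost surely no receiver is within `rI` of `a`.
  set B := Metric.closedBall a (max (rI + Rp) RI)
  have hvoid := h.transmitters.measure_forall_notMem (B := B)
    Metric.isClosed_closedBall.measurableSet measure_closedBall_lt_top.ne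
  have hpos : 0 < P {ω | ∀ i, T i ω ∉ B} := by
    rw [hvoid]
    exact ENNReal.ofReal_pos.2 (Real.exp_pos _)
  refine hpos.trans_le (measure_mono_ae ?_)
  filter_upwards [h.ae_dist_receiver_le] with ω hω hT
  refine seesOpportunity_iff.2 fun i => ?_
  have h1 : max (rI + Rp) RI < dist a (T i ω) := by
    have := hT i
    rwa [Metric.mem_closedBall, not_le, dist_comm] at this
  have h2 := max_lt_iff.1 h1
  refine ⟨?_, h2.2⟩
  linarith [hω i, dist_triangle a (V i ω) (T i ω)]

theorem opportunityEvent_ae_eq (h : IsPrimaryNetwork P lamPT Rp T V) {rI RI : ℝ}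
    (hr : Rp + RI ≤ rI) (x : Plane) :
    opportunityEvent rI RI T V x =ᵐ[P] {ω | ∀ i, V i ω ∉ Metric.closedBall x rI} := by
  filter_upwards [h.ae_dist_receiver_le] with ω hω
  refine propext (seesOpportunity_iff.trans (forall_congr' fun i => ?_))
  rw [Metric.mem_closedBall, not_le, dist_comm (V i ω) x]
  refine ⟨fun h1 => h1.1, fun h1 => ⟨h1, ?_⟩⟩
  have h2 := dist_triangle x (T i ω) (V i ω)
  rw [dist_comm (T i ω)] at h2
  linarith [hω i]

/-- Both events are voids of disks, so the joint one is the void of the union; splitting off the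
disk around `a` leaves the crescent. -/
theorem measure_opportunityEvent_inter_le [IsProbabilityMeasure P]
    (h : IsPrimaryNetwork P lamPT Rp T V) (hRp : 0 < Rp) {rI RI : ℝ} (hRI : 0 < RI)
    (hr : Rp + RI ≤ rI) {x a : Plane} (hx : dist x a ≤ rI) :
    P (opportunityEvent rI RI T V a ∩ opportunityEvent rI RI T V x) ≤
      P (opportunityEvent rI RI T V a) *
        ENNReal.ofReal (Real.exp (-(lamPT * rI * dist x a))) := by
  set A := Metric.closedBall a rI
  set B := Metric.closedBall x rI
  have hA : MeasurableSet A := Metric.isClosed_closedBall.measurableSet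
  have hB : MeasurableSet B := Metric.isClosed_closedBall.measurableSet
  have hAt : volume A ≠ ∞ := measure_closedBall_lt_top.ne
  have hBt : volume (B \ A) ≠ ∞ :=
    ne_top_of_le_ne_top measure_closedBall_lt_top.ne (measure_mono Set.sdiff_subset)
  have hAb : Bornology.IsBounded A := Metric.isBounded_closedBall
  have hBb : Bornology.IsBounded B := Metric.isBounded_closedBall
  rw [measure_congr ((h.opportunityEvent_ae_eq hr a).inter (h.opportunityEvent_ae_eq hr x)),
    measure_congr (h.opportunityEvent_ae_eq hr a),
    h.measure_forall_receiver_notMem hRp hA hAb]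
  have hunion : ({ω | ∀ i, V i ω ∉ A} ∩ {ω | ∀ i, V i ω ∉ B} : Set Ω) =
      {ω | ∀ i, V i ω ∉ A ∪ B} := by
    ext ω
    simp [forall_and]
  rw [hunion, h.measure_forall_receiver_notMem hRp (hA.union hB) (hAb.union hBb),
    ← ENNReal.ofReal_mul (Real.exp_pos _).le, ← Real.exp_add]
  refine ENNReal.ofReal_le_ofReal (Real.exp_le_exp.2 ?_)
  rw [← Set.union_sdiff_self, measure_union Set.disjoint_sdiff_right (hB.diff hA),
    ENNReal.toReal_add hAt hBt]
  have hcres := (ENNReal.ofReal_le_iff_le_toReal hBt).1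
    (ofReal_mul_dist_le_volume_closedBall_diff (by linarith) hx)
  have := mul_le_mul_of_nonneg_left hcres lamPT.coe_nonneg
  linarith

end IsPrimaryNetwork

/-! ### Campbell's formula and the degree bound. -/

namespace IsHeterogeneousNetwork

variable {Ω : Type*} [MeasurableSpace Ω] {P : Measure Ω} [IsProbabilityMeasure P]
  {lamS lamPT : ℝ≥0} {Rp : ℝ} {T V U : ℕ → Ω → Plane}

/-- Independence of `U i` from the primary network allows its position to be frozen at `x` by
Fubini. -/
theorem measure_user_linked (h : IsHeterogeneousNetwork P lamS lamPT Rp T V U) (rp rI RI : ℝ)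
    (a : Plane) (i : ℕ) :
    MeasurableSet {ω | U i ω ∈ Metric.closedBall a rp ∧ ω ∈ opportunityEvent rI RI T V a ∧
      ω ∈ opportunityEvent rI RI T V (U i ω)} ∧
    P {ω | U i ω ∈ Metric.closedBall a rp ∧ ω ∈ opportunityEvent rI RI T V a ∧
      ω ∈ opportunityEvent rI RI T V (U i ω)} =
    ∫⁻ x in Metric.closedBall a rp,
      P (opportunityEvent rI RI T V a ∩ opportunityEvent rI RI T V x) ∂(P.map (U i)) := by
  have hB : MeasurableSet (Metric.closedBall a rp) := Metric.isClosed_closedBall.measurableSet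
  have hZ := h.primary.measurable_pair
  have hU := h.secondary.measurable i
  set G : Set (((ℕ → Plane) × (ℕ → Plane)) × Plane) := {z | z.2 ∈ Metric.closedBall a rp ∧
    SeesOpportunity rI RI z.1.1 z.1.2 a ∧ SeesOpportunity rI RI z.1.1 z.1.2 z.2}
  have hG : MeasurableSet G := (measurable_snd hB).inter
    (MeasurableSet.inter ((measurable_fst.prodMk measurable_const)
      (measurableSet_seesOpportunity rI RI)) (measurableSet_seesOpportunity rI RI))
  refine ⟨(hZ.prodMk hU) hG, ?_⟩
  have hind : IndepFun (fun ω => ((fun i => T i ω), (fun i => V i ω))) (U i) P :=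
    h.indep.comp measurable_id (measurable_pi_apply i)
  have hmap := (indepFun_iff_map_prod_eq_prod_map_map hZ.aemeasurable hU.aemeasurable).1 hind
  have := Measure.isProbabilityMeasure_map (μ := P) hZ.aemeasurable
  have := Measure.isProbabilityMeasure_map (μ := P) hU.aemeasurable
  change P ((fun ω => (((fun i => T i ω), (fun i => V i ω)), U i ω)) ⁻¹' G) = _
  rw [← Measure.map_apply (hZ.prodMk hU) hG, hmap, Measure.prod_apply_symm hG,
    ← lintegral_indicator hB]
  refine lintegral_congr fun x => ?_
  rw [Measure.map_apply hZ (measurable_prodMk_right hG)]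
  by_cases hx : x ∈ Metric.closedBall a rp
  · rw [Set.indicator_of_mem hx]
    congr 1
    ext ω
    exact ⟨fun hω => hω.2, fun hω => ⟨hx, hω⟩⟩
  · rw [Set.indicator_of_notMem hx]
    convert! measure_empty (μ := P)
    rw [Set.eq_empty_iff_forall_notMem]
    exact fun ω hω => hx hω.1

/-- Summing the link probabilities over all users replaces the individual laws of the `U i` by the
intensity `lamS • volume`. -/
theorem condAvgDegree_eq (h : IsHeterogeneousNetwork P lamS lamPT Rp T V U) (rp rI RI : ℝ)
    (a : Plane) :
    condAvgDegree P rp rI RI T V U a = (P (opportunityEvent rI RI T V a))⁻¹ *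
      (lamS * ∫⁻ x in Metric.closedBall a rp,
        P (opportunityEvent rI RI T V a ∩ opportunityEvent rI RI T V x)) := by
  set E := opportunityEvent rI RI T V a
  have hE : MeasurableSet E := h.primary.measurableSet_opportunityEvent rI RI a
  set L : ℕ → Set Ω := fun i => {ω | U i ω ∈ Metric.closedBall a rp ∧ ω ∈ E ∧
      ω ∈ opportunityEvent rI RI T V (U i ω)}
  have hL : ∀ i, MeasurableSet (L i) := fun i => (h.measure_user_linked rp rI RI a i).1
  have hdeg : ∀ ω, (userDegree rp rI RI (fun i => T i ω) (fun i => V i ω) (fun i => U i ω) a :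
      ℝ≥0∞) = ∑' i, (L i).indicator 1 ω := fun ω => userDegree_toENNReal_eq_tsum ..
  rw [condAvgDegree, ProbabilityTheory.cond, lintegral_smul_measure, smul_eq_mul]
  congr 1
  simp_rw [hdeg]
  rw [lintegral_tsum fun i => (measurable_one.indicator (hL i)).aemeasurable]
  have hterm : ∀ i, ∫⁻ ω in E, (L i).indicator 1 ω ∂P = ∫⁻ x in Metric.closedBall a rp,
      P (E ∩ opportunityEvent rI RI T V x) ∂(P.map (U i)) := by
    intro i
    rw [← (h.measure_user_linked rp rI RI a i).2, lintegral_indicator_one (hL i),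
      Measure.restrict_apply (hL i), Set.inter_eq_left.2 fun ω hω => hω.2.1]
  rw [tsum_congr hterm]
  rw [← lintegral_sum_measure, ← Measure.restrict_sum _ Metric.isClosed_closedBall.measurableSet,
    h.secondary.sum_map, Measure.restrict_smul, lintegral_smul_measure]
  rfl

theorem condAvgDegree_lt_top (h : IsHeterogeneousNetwork P lamS lamPT Rp T V U)
    (rp rI RI : ℝ) (a : Plane) : condAvgDegree P rp rI RI T V U a < ∞ := by
  rw [h.condAvgDegree_eq]
  refine ENNReal.mul_lt_top
    (ENNReal.inv_lt_top.2 (h.primary.measure_opportunityEvent_pos rI RI a))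
    (ENNReal.mul_lt_top ENNReal.coe_lt_top ?_)
  refine (lintegral_mono fun x => prob_le_one).trans_lt ?_
  rw [setLIntegral_one]
  exact measure_closedBall_lt_top

theorem condAvgDegree_le (h : IsHeterogeneousNetwork P lamS lamPT Rp T V U) (hRp : 0 < Rp)
    (hlamPT : 0 < lamPT) {rp rI RI : ℝ} (hRI : 0 < RI) (hr : Rp + RI ≤ rI) (hrp : rp ≤ rI)
    (a : Plane) :
    condAvgDegree P rp rI RI T V U a ≤
      ENNReal.ofReal (2 * lamS * Real.pi / ((lamPT : ℝ) ^ 2 * rI ^ 2)) := by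
  have hrI : 0 < rI := by linarith
  have hlam : (0 : ℝ) < lamPT := hlamPT
  rw [h.condAvgDegree_eq]
  set p := P (opportunityEvent rI RI T V a)
  have hp0 : p ≠ 0 := (h.primary.measure_opportunityEvent_pos rI RI a).ne'
  have hpt : p ≠ ∞ := measure_ne_top _ _
  have hm : Measurable fun x : Plane => ENNReal.ofReal (Real.exp (-(lamPT * rI * dist x a))) :=
    ENNReal.measurable_ofReal.comp (by fun_prop)
  have hint : ∫⁻ x in Metric.closedBall a rp,
      P (opportunityEvent rI RI T V a ∩ opportunityEvent rI RI T V x) ≤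
      p * ENNReal.ofReal (2 * Real.pi / (lamPT * rI) ^ 2) := by
    rw [← lintegral_exp_neg_mul_dist (mul_pos hlam hrI) a, ← lintegral_const_mul _ hm]
    refine (setLIntegral_mono (hm.const_mul p) fun x hx => ?_).trans
      (setLIntegral_le_lintegral _ _)
    exact h.primary.measure_opportunityEvent_inter_le hRp hRI hr (hx.trans hrp)
  calc p⁻¹ * (lamS * ∫⁻ x in Metric.closedBall a rp,
        P (opportunityEvent rI RI T V a ∩ opportunityEvent rI RI T V x))
      ≤ p⁻¹ * (lamS * (p * ENNReal.ofReal (2 * Real.pi / (lamPT * rI) ^ 2))) := by gcongr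
    _ = lamS * ENNReal.ofReal (2 * Real.pi / (lamPT * rI) ^ 2) := by
        rw [mul_left_comm, ← mul_assoc p⁻¹, ENNReal.inv_mul_cancel hp0 hpt, one_mul]
    _ = _ := by
        rw [← ENNReal.ofReal_coe_nnreal, ← ENNReal.ofReal_mul lamS.coe_nonneg]
        congr 1
        rw [mul_pow]
        ring

end IsHeterogeneousNetwork

theorem corollary3 {Ω : Type*} [MeasurableSpace Ω] (P : Measure Ω) [IsProbabilityMeasure P]
    (lamS lamPT : ℝ≥0) (hlamS : 0 < lamS) (hlamPT : 0 < lamPT)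
    (Rp RI : ℝ) (hRp : 0 < Rp) (hRI : 0 < RI)
    (T V U : ℕ → Ω → Plane) (hnet : IsHeterogeneousNetwork P lamS lamPT Rp T V U)
    (a : Plane)
    (α β c : ℝ) (hα : 0 < α) (hβ0 : 0 < β) (hβ1 : β < 1) (hc : 0 < c)
    (rp rI : ℝ → ℝ) (hrI : ∀ p, 0 < p → rI p = c * p ^ (1 / α))
    (hrp : ∀ p, 0 < p → rp p = β * rI p) :
    (∀ p, 0 < p → 0 < P (opportunityEvent (rI p) RI T V a) ∧
      condAvgDegree P (rp p) (rI p) RI T V U a < ∞) ∧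
    ((fun p => (condAvgDegree P (rp p) (rI p) RI T V U a).toReal)
      =O[atTop] fun p : ℝ => p ^ (-2 / α)) ∧
    (∀ p, 0 < p → Rp + RI ≤ rI p →
      condAvgDegree P (rp p) (rI p) RI T V U a ≤
        ENNReal.ofReal (2 * lamS * Real.pi / ((lamPT : ℝ) ^ 2 * rI p ^ 2))) := by
  have hbound : ∀ p, 0 < p → Rp + RI ≤ rI p →
      condAvgDegree P (rp p) (rI p) RI T V U a ≤
        ENNReal.ofReal (2 * lamS * Real.pi / ((lamPT : ℝ) ^ 2 * rI p ^ 2)) := by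
    intro p hp hr
    refine hnet.condAvgDegree_le hRp hlamPT hRI hr ?_ a
    rw [hrp p hp]
    exact mul_le_of_le_one_left (by linarith) hβ1.le
  refine ⟨fun p _ => ⟨hnet.primary.measure_opportunityEvent_pos _ _ a,
    hnet.condAvgDegree_lt_top _ _ _ a⟩, ?_, hbound⟩
  have hlarge : ∀ᶠ p : ℝ in atTop, Rp + RI ≤ c * p ^ (1 / α) :=
    ((tendsto_rpow_atTop (one_div_pos.2 hα)).const_mul_atTop hc).eventually_ge_atTop _
  -- The constant is what remains of the explicit bound once `rI p ^ 2 = c ^ 2 * p ^ (2 / α)` is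
  -- substituted.
  refine IsBigO.of_bound (2 * lamS * Real.pi / ((lamPT : ℝ) ^ 2 * c ^ 2)) ?_
  filter_upwards [hlarge, eventually_gt_atTop 0] with p hp hp0
  have hb := ENNReal.toReal_le_of_le_ofReal (by positivity)
    (hbound p hp0 (by rw [hrI p hp0]; exact hp))
  rw [Real.norm_of_nonneg ENNReal.toReal_nonneg, Real.norm_of_nonneg (by positivity)]
  refine hb.trans_eq ?_
  have hpow : p ^ (-2 / α) = ((p ^ (1 / α)) ^ 2)⁻¹ := by
    rw [← Real.rpow_natCast, ← Real.rpow_mul hp0.le, ← Real.rpow_neg hp0.le]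
    congr 1
    push_cast
    ring
  rw [hrI p hp0, hpow, mul_pow]
  field_simp
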